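/- Let $n, r \ge 0$ be integers and let $U$ be the universal enveloping algebra over $\mathbb{C}$ of the Lie algebra $\mathfrak{gl}_n(\mathbb{C})$, with generators $e_{ij}$ $(1 \le i,j \le n)$ corresponding to the matrix units. Let $U'_{\mathbb{Z}}$ be the subring of $U$ generated by all divided powers $e_{ij}^m/m!$ with $i \ne j$ and $m \ge 0$ (the Kostant $\mathbb{Z}$-form of the enveloping algebra of $\mathfrak{sl}_n(\mathbb{C})$, the latter being identified with a subalgebra of $U$), and let $U_{\mathbb{Z}}$ be the subring of $U$ generated by $U'_{\mathbb{Z}}$ and all elements $$\binom{e_{ii}}{m} = \frac{e_{ii}(e_{ii}-1)\cdots(e_{ii}-m+1)}{m!} \qquad (1 \le i \le n,\ m \ge 0)$$ (the Kostant $\mathbb{Z}$-form of $U$). Let $V = \mathbb{C}^n$ be the natural module, with standard basis $v_1, \dots, v_n$, so that $e_{ij} v_a = \delta_{aj} v_i$, and let $V_{\mathbb{Z}} = \sum_i \mathbb{Z} v_i$. The $U$-module structure on $V^{\otimes r}$, in which $\mathfrak{gl}_n(\mathbb{C})$ acts by $x(y_1 \otimes \cdots \otimes y_r) = \sum_{p}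 y_1 \otimes \cdots \otimes x y_p \otimes \cdots \otimes y_r$, restricts to a $U_{\mathbb{Z}}$-module structure, and hence also a $U'_{\mathbb{Z}}$-module structure, on $V_{\mathbb{Z}}^{\otimes r}$ (tensor power over $\mathbb{Z}$). The symmetric group $\mathfrak{S}_r$ acts on $V_{\mathbb{Z}}^{\otimes r}$ by place permutations, $\sigma(y_1 \otimes \cdots \otimes y_r) = y_{\sigma^{-1}(1)} \otimes \cdots \otimes y_{\sigma^{-1}(r)}$, and this action commutes with that of $U_{\mathbb{Z}}$. Then, for all $n$ and $r$, the natural ring homomorphism $$\mathbb{Z}\mathfrak{S}_r \to \operatorname{End}_{U_{\mathbb{Z}}}(V_{\mathbb{Z}}^{\otimes r})$$ is surjective, and likewise the natural ring homomorphism $$\mathbb{Z}\mathfrak{S}_r \to \operatorname{End}_{U'_{\mathbb{Z}}}(V_{\mathbb{Z}}^{\otimes r})$$ is surjective. -/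

import Mathlib

open scoped TensorProduct Nat

noncomputable section

namespace SchurWeyl

attribute [local instance] LieRing.ofAssociativeRing

/-- The Lie algebra `𝔤𝔩ₙ(ℂ)` of all `n × n` complex matrices, with the commutator bracket. -/
abbrev gl (n : ℕ) : Type := Matrix (Fin n) (Fin n) ℂ

/-- The universal enveloping algebra `U` of `𝔤𝔩ₙ(ℂ)` over `ℂ`. -/
abbrev U (n : ℕ) : Type := UniversalEnvelopingAlgebra ℂ (gl n)

/-- The generator `e i j` of `U`: the image of the matrix unit with a `1` in position `(i, j)`. -/
def e {n : ℕ} (i j : Fin n) : U n :=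
  UniversalEnvelopingAlgebra.ι ℂ (Matrix.single i j (1 : ℂ) : gl n)

/-- The divided power `x ^ m / m!`. -/
def dividedPower {n : ℕ} (x : U n) (m : ℕ) : U n := ((m ! : ℂ)⁻¹) • x ^ m

/-- The binomial element `x (x - 1) ⋯ (x - m + 1) / m!`. -/
def binomial {n : ℕ} (x : U n) (m : ℕ) : U n :=
  ((m ! : ℂ)⁻¹) • Polynomial.aeval x (descPochhammer ℂ m)

/-- `U'_ℤ`, the subring of `U` generated by the divided powers of the `e i j` with `i ≠ j`:
the Kostant `ℤ`-form of the enveloping algebra of `𝔰𝔩ₙ(ℂ)`. -/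
def kostantFormSL (n : ℕ) : Subring (U n) :=
  Subring.closure {u | ∃ (i j : Fin n) (m : ℕ), i ≠ j ∧ u = dividedPower (e i j) m}

/-- `U_ℤ`, the subring of `U` generated by `U'_ℤ` and the binomial elements of the `e i i`:
the Kostant `ℤ`-form of the enveloping algebra of `𝔤𝔩ₙ(ℂ)`. -/
def kostantFormGL (n : ℕ) : Subring (U n) :=
  Subring.closure ((kostantFormSL n : Set (U n)) ∪
    {u | ∃ (i : Fin n) (m : ℕ), u = binomial (e i i) m})

theorem kostantFormSL_le (n : ℕ) : kostantFormSL n ≤ kostantFormGL n :=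
  fun _ hu => Subring.subset_closure (Or.inl hu)

/-- The `r`-th tensor power of `V = ℂⁿ` over `ℂ`. -/
abbrev VPow (n r : ℕ) : Type := ⨂[ℂ] _ : Fin r, (Fin n → ℂ)

/-- The `r`-th tensor power of `V_ℤ = ℤⁿ` over `ℤ`. -/
abbrev VZPow (n r : ℕ) : Type := ⨂[ℤ] _ : Fin r, (Fin n → ℤ)

/-- A matrix acting on the `p`-th tensor factor only. -/
def slot {n r : ℕ} (p : Fin r) (A : gl n) : Module.End ℂ (VPow n r) :=
  PiTensorProduct.mapMonoidHom (Pi.mulSingle p (Matrix.toLin' A))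

theorem slot_tprod {n r : ℕ} (p : Fin r) (A : gl n) (v : Fin r → Fin n → ℂ) :
    slot p A (PiTensorProduct.tprod ℂ v) =
      PiTensorProduct.tprod ℂ (Function.update v p (A.mulVec (v p))) := by
  simp only [slot, PiTensorProduct.mapMonoidHom_apply, PiTensorProduct.map_tprod]
  congr 1
  ext1 q
  by_cases h : q = p
  · subst h; simp
  · simp [h]

theorem slot_commute {n r : ℕ} {p q : Fin r} (h : p ≠ q) (A B : gl n) :
    Commute (slot p A) (slot q B) :=
  (Pi.mulSingle_commute h _ _).map PiTensorProduct.mapMonoidHom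

theorem slot_mul {n r : ℕ} (p : Fin r) (A B : gl n) :
    slot p (A * B) = slot p A * slot p B := by
  simp only [slot]
  rw [← map_mul, ← Pi.mulSingle_mul, Matrix.toLin'_mul]
  rfl

theorem slot_add {n r : ℕ} (p : Fin r) (A B : gl n) :
    slot p (A + B) = slot p A + slot p B := by
  refine PiTensorProduct.ext (MultilinearMap.ext fun v => ?_)
  simp [slot_tprod, Matrix.add_mulVec]

theorem slot_smul {n r : ℕ} (p : Fin r) (c : ℂ) (A : gl n) :
    slot p (c • A) = c • slot p A := by
  refine PiTensorProduct.ext (MultilinearMap.ext fun v => ?_)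
  simp [slot_tprod, Matrix.smul_mulVec]

/-- The action of `𝔤𝔩ₙ(ℂ)` on `V^{⊗ r}`:
`A (v₁ ⊗ ⋯ ⊗ vᵣ) = ∑ p, v₁ ⊗ ⋯ ⊗ A vₚ ⊗ ⋯ ⊗ vᵣ`. -/
def glAction (n r : ℕ) : gl n →ₗ⁅ℂ⁆ Module.End ℂ (VPow n r) where
  toFun A := ∑ p, slot p A
  map_add' A B := by simp [slot_add, Finset.sum_add_distrib]
  map_smul' c A := by simp [slot_smul, Finset.smul_sum]
  map_lie' {A B} := by
    have h : ∀ p q : Fin r, slot p A * slot q B =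
        (if p = q then slot p ⁅A, B⁆ else 0) + slot q B * slot p A := by
      intro p q
      split_ifs with hpq
      · subst hpq
        rw [← slot_mul, ← slot_mul, ← slot_add, Ring.lie_def, sub_add_cancel]
      · rw [zero_add, (slot_commute hpq A B).eq]
    have h' : (∑ p : Fin r, slot p A) * (∑ q : Fin r, slot q B) =
        ∑ p : Fin r, slot p ⁅A, B⁆ + (∑ q : Fin r, slot q B) * (∑ p : Fin r, slot p A) := by
      rw [Finset.sum_mul_sum, Finset.sum_mul_sum,
        Finset.sum_comm (f := fun q p => slot q B * slot p A), ← Finset.sum_add_distrib]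
      refine Finset.sum_congr rfl fun p _ => ?_
      simp only [h p, Finset.sum_add_distrib, Finset.sum_ite_eq, Finset.mem_univ, if_true]
    exact (sub_eq_of_eq_add h').symm

/-- The resulting action of the enveloping algebra `U` on `V^{⊗ r}`. -/
def uAction (n r : ℕ) : U n →ₐ[ℂ] Module.End ℂ (VPow n r) :=
  UniversalEnvelopingAlgebra.lift ℂ (glAction n r)

theorem uAction_e {n r : ℕ} (i j : Fin n) :
    uAction n r (e i j) = ∑ p : Fin r, slot p (Matrix.single i j 1) := by
  exact UniversalEnvelopingAlgebra.lift_ι_apply ℂ (glAction n r) (Matrix.single i j (1 : ℂ))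

/-- The inclusion of `V_ℤ = ℤⁿ` in `V = ℂⁿ`. -/
def castVec (n : ℕ) : (Fin n → ℤ) →ₗ[ℤ] (Fin n → ℂ) :=
  (Algebra.linearMap ℤ ℂ).compLeft (Fin n)

/-- The canonical map from `V_ℤ^{⊗ r}` to `V^{⊗ r}`. -/
def incl (n r : ℕ) : VZPow n r →ₗ[ℤ] VPow n r :=
  PiTensorProduct.lift
    { toFun := fun v => PiTensorProduct.tprod ℂ fun p => castVec n (v p)
      map_update_add' := by
        intro _ v p x y
        have h : ∀ z, (fun q => castVec n (Function.update v p z q)) =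
            Function.update (fun q => castVec n (v q)) p (castVec n z) := fun z =>
          funext fun q => Function.apply_update (fun _ => castVec n) v p z q
        simp only [h, map_add, MultilinearMap.map_update_add]
      map_update_smul' := by
        intro _ v p c x
        have h : ∀ z, (fun q => castVec n (Function.update v p z q)) =
            Function.update (fun q => castVec n (v q)) p (castVec n z) := fun z =>
          funext fun q => Function.apply_update (fun _ => castVec n) v p z q
        simp only [h, map_smul, ← Int.cast_smul_eq_zsmul ℂ, MultilinearMap.map_update_smul] }

theorem incl_tprod {n r : ℕ} (v : Fin r → Fin n → ℤ) :
    incl n r (PiTensorProduct.tprod ℤ v) =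
      PiTensorProduct.tprod ℂ (fun p i => (v p i : ℂ)) := by
  simp only [incl, PiTensorProduct.lift.tprod]
  rfl

/-- The standard basis of `V_ℤ^{⊗ r}`. -/
def basisZ (n r : ℕ) : Module.Basis (Fin r → Fin n) ℤ (VZPow n r) :=
  Basis.piTensorProduct fun _ => Pi.basisFun ℤ (Fin n)

/-- The standard basis of `V^{⊗ r}`. -/
def basisC (n r : ℕ) : Module.Basis (Fin r → Fin n) ℂ (VPow n r) :=
  Basis.piTensorProduct fun _ => Pi.basisFun ℂ (Fin n)

theorem incl_basisZ {n r : ℕ} (f : Fin r → Fin n) : incl n r (basisZ n r f) = basisC n r f := by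
  simp only [basisZ, basisC, Basis.piTensorProduct_apply, incl_tprod]
  congr 1
  ext p i
  simp [Pi.single_apply]

theorem incl_injective (n r : ℕ) : Function.Injective (incl n r) := by
  have key : ∀ x f, (basisC n r).repr (incl n r x) f = (((basisZ n r).repr x f : ℤ) : ℂ) := by
    intro x f
    conv_lhs => rw [← (basisZ n r).sum_repr x]
    simp only [map_sum, map_smul, incl_basisZ, Finsupp.finsetSum_apply]
    simp [← Int.cast_smul_eq_zsmul ℂ, Finsupp.single_apply]
  intro x y hxy
  refine (basisZ n r).repr.injective (Finsupp.ext fun f => ?_)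
  have := key x f
  rw [hxy, key y f] at this
  exact_mod_cast this.symm

/-- The endomorphisms of `V^{⊗ r}` that map the lattice `V_ℤ^{⊗ r}` into itself. -/
def latticeEnd (n r : ℕ) : Subring (Module.End ℂ (VPow n r)) where
  carrier := {T | ∀ x, T (incl n r x) ∈ LinearMap.range (incl n r)}
  mul_mem' := by
    intro S T hS hT x
    obtain ⟨y, hy⟩ := hT x
    rw [Module.End.mul_apply, ← hy]
    exact hS y
  one_mem' x := ⟨x, rfl⟩
  add_mem' hS hT x := Submodule.add_mem _ (hS x) (hT x)
  zero_mem' x := Submodule.zero_mem _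
  neg_mem' hS x := Submodule.neg_mem _ (hS x)

theorem mem_latticeEnd_of_basis {n r : ℕ} {T : Module.End ℂ (VPow n r)}
    (h : ∀ f, T (basisC n r f) ∈ LinearMap.range (incl n r)) : T ∈ latticeEnd n r := by
  intro x
  rw [← (basisZ n r).sum_repr x]
  simp only [map_sum, map_zsmul, map_smul, incl_basisZ]
  exact Submodule.sum_mem _ fun f _ => Submodule.smul_mem _ _ (h f)

theorem slot_single_mem {n r : ℕ} (p : Fin r) (i j : Fin n) :
    slot p (Matrix.single i j 1) ∈ latticeEnd n r := by
  apply mem_latticeEnd_of_basis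
  intro f
  refine ⟨PiTensorProduct.tprod ℤ (Function.update (fun q => Pi.single (f q) 1) p
    ((Matrix.single i j (1 : ℤ)).mulVec (Pi.single (f p) 1))), ?_⟩
  simp only [basisC, Basis.piTensorProduct_apply, incl_tprod, slot_tprod]
  congr 1
  ext q k
  by_cases h : q = p
  · subst h
    simp [Matrix.single_apply]
  · simp [h, Pi.single_apply]

theorem dividedPower_mem_aux {n r : ℕ} {i j : Fin n} (hij : i ≠ j) (s : Finset (Fin r)) :
    ∀ m : ℕ, ((m ! : ℂ)⁻¹) • (∑ p ∈ s, slot p (Matrix.single i j 1)) ^ m ∈ latticeEnd n r := by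
  classical
  induction s using Finset.induction_on with
  | empty =>
    intro m
    rcases m with _ | m
    · simp
    · simp
  | insert p s hp ih =>
    intro m
    rw [Finset.sum_insert hp]
    have hc : Commute (slot p (Matrix.single i j 1) : Module.End ℂ (VPow n r))
        (∑ p ∈ s, slot p (Matrix.single i j 1)) :=
      Commute.sum_right _ _ _ fun q hq => slot_commute (ne_of_mem_of_not_mem hq hp).symm _ _
    have hsq : (slot p (Matrix.single i j 1) : Module.End ℂ (VPow n r)) ^ 2 = 0 := by
      rw [sq, ← slot_mul, Matrix.single_mul_single_of_ne _ _ _ _ hij.symm]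
      simpa using slot_smul (r := r) p (0 : ℂ) (0 : gl n)
    rw [hc.add_pow, Finset.smul_sum]
    refine Subring.sum_mem _ fun k hk => ?_
    have hkm : k ≤ m := Nat.lt_succ_iff.1 (Finset.mem_range.1 hk)
    have hfac : ((m ! : ℂ)⁻¹) * (m.choose k : ℂ) = ((k ! : ℂ)⁻¹) * (((m - k)! : ℂ)⁻¹) := by
      have h := Nat.choose_mul_factorial_mul_factorial hkm
      have h' : (m.choose k : ℂ) * (k ! : ℂ) * ((m - k)! : ℂ) = (m ! : ℂ) := by exact_mod_cast h
      have h1 : (k ! : ℂ) ≠ 0 := by exact_mod_cast k.factorial_ne_zero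
      have h2 : ((m - k)! : ℂ) ≠ 0 := by exact_mod_cast (m - k).factorial_ne_zero
      have h3 : (m ! : ℂ) ≠ 0 := by exact_mod_cast m.factorial_ne_zero
      field_simp
      rw [← h']
    have hterm : ((m ! : ℂ)⁻¹) • ((slot p (Matrix.single i j 1) : Module.End ℂ (VPow n r)) ^ k *
          (∑ p ∈ s, slot p (Matrix.single i j 1)) ^ (m - k) * (m.choose k : ℕ)) =
        (((k ! : ℂ)⁻¹) • (slot p (Matrix.single i j 1) : Module.End ℂ (VPow n r)) ^ k) *
        ((((m - k)! : ℂ)⁻¹) • (∑ p ∈ s, slot p (Matrix.single i j 1)) ^ (m - k)) := by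
      rw [smul_mul_smul_comm, ← hfac, mul_smul]
      congr 1
      rw [← nsmul_eq_mul', Nat.cast_smul_eq_nsmul]
    rw [hterm]
    refine Subring.mul_mem _ ?_ (ih _)
    rcases k with _ | _ | k
    · simp
    · simpa using slot_single_mem p i j
    · rw [pow_add _ k 2, hsq, mul_zero, smul_zero]
      exact (latticeEnd n r).zero_mem

theorem uAction_dividedPower_mem {n r : ℕ} {i j : Fin n} (hij : i ≠ j) (m : ℕ) :
    uAction n r (dividedPower (e i j) m) ∈ latticeEnd n r := by
  rw [dividedPower, map_smul, map_pow, uAction_e]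
  exact dividedPower_mem_aux hij _ m

theorem uAction_e_self_basis {n r : ℕ} (i : Fin n) (f : Fin r → Fin n) :
    uAction n r (e i i) (basisC n r f) =
      ((Finset.univ.filter fun p => f p = i).card : ℂ) • basisC n r f := by
  have h : ∀ p : Fin r, slot p (Matrix.single i i 1) (basisC n r f) =
      (if f p = i then (1 : ℂ) else 0) • basisC n r f := by
    intro p
    simp only [basisC, Basis.piTensorProduct_apply, slot_tprod, Pi.basisFun_apply]
    have h1 : (Matrix.single i i (1 : ℂ)).mulVec (Pi.single (f p) 1) =
        (if f p = i then (1 : ℂ) else 0) • (Pi.single (f p) 1 : Fin n → ℂ) := by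
      ext k
      by_cases hf : f p = i
      · subst hf; simp [Matrix.single_apply, Pi.single_apply, eq_comm]
      · simp [hf, Ne.symm hf]
    rw [h1, MultilinearMap.map_update_smul, Function.update_eq_self]
  rw [uAction_e, LinearMap.sum_apply]
  simp only [h]
  rw [← Finset.sum_smul]
  simp

theorem uAction_binomial_mem {n r : ℕ} (i : Fin n) (m : ℕ) :
    uAction n r (binomial (e i i) m) ∈ latticeEnd n r := by
  apply mem_latticeEnd_of_basis
  intro f
  set c := (Finset.univ.filter fun p => f p = i).card with hc
  have hp : ∀ P : Polynomial ℂ, Polynomial.aeval (uAction n r (e i i)) P (basisC n r f) =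
      P.eval (c : ℂ) • basisC n r f := by
    intro P
    induction P using Polynomial.induction_on' with
    | add P Q hP hQ =>
      rw [map_add, LinearMap.add_apply, hP, hQ, Polynomial.eval_add, add_smul]
    | monomial k a =>
      have hk : ∀ k : ℕ, (uAction n r (e i i) ^ k) (basisC n r f) =
          ((c : ℂ) ^ k) • basisC n r f := by
        intro k
        induction k with
        | zero => simp
        | succ k ih =>
          rw [pow_succ', Module.End.mul_apply, ih, map_smul, uAction_e_self_basis, smul_smul,
            pow_succ]
      rw [Polynomial.aeval_monomial, Module.End.mul_apply, hk, Polynomial.eval_monomial,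
        Module.algebraMap_end_apply, smul_smul]
  rw [binomial, map_smul, ← Polynomial.aeval_algHom_apply, LinearMap.smul_apply, hp,
    descPochhammer_eval_eq_descFactorial, Nat.descFactorial_eq_factorial_mul_choose, smul_smul]
  have h3 : (m ! : ℂ) ≠ 0 := by exact_mod_cast m.factorial_ne_zero
  refine ⟨(c.choose m : ℤ) • basisZ n r f, ?_⟩
  rw [map_smul, incl_basisZ, Nat.cast_mul, inv_mul_cancel_left₀ h3, natCast_zsmul,
    Nat.cast_smul_eq_nsmul]

/-- `V_ℤ^{⊗ r}` is stable under `U_ℤ`. -/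
theorem uAction_mem_latticeEnd {n r : ℕ} {u : U n} (hu : u ∈ kostantFormGL n) :
    uAction n r u ∈ latticeEnd n r := by
  have h' : kostantFormSL n ≤ (latticeEnd n r).comap (uAction n r).toRingHom := by
    refine Subring.closure_le.2 ?_
    rintro _ ⟨i, j, m, hij, rfl⟩
    exact uAction_dividedPower_mem hij m
  have h : kostantFormGL n ≤ (latticeEnd n r).comap (uAction n r).toRingHom := by
    refine Subring.closure_le.2 (Set.union_subset h' ?_)
    rintro _ ⟨i, m, rfl⟩
    exact uAction_binomial_mem i m
  exact h hu

/-- `u x` for `u` in `U_ℤ` and `x` in `V_ℤ^{⊗ r}`: the unique element of `V_ℤ^{⊗ r}` whose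
image in `V^{⊗ r}` is the result of applying `u` to the image of `x`. -/
def kostantSMul {n r : ℕ} (u : kostantFormGL n) (x : VZPow n r) : VZPow n r :=
  (uAction_mem_latticeEnd (r := r) u.2 x).choose

theorem incl_kostantSMul {n r : ℕ} (u : kostantFormGL n) (x : VZPow n r) :
    incl n r (kostantSMul u x) = uAction n r u (incl n r x) :=
  (uAction_mem_latticeEnd (r := r) u.2 x).choose_spec

/-- The `U_ℤ`-module `V_ℤ^{⊗ r}`. -/
instance moduleGL (n r : ℕ) : Module (kostantFormGL n) (VZPow n r) where
  smul := kostantSMul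
  one_smul x := incl_injective n r ((incl_kostantSMul _ _).trans (by simp))
  mul_smul u v x := incl_injective n r ((incl_kostantSMul _ _).trans (by
    refine Eq.trans ?_ (incl_kostantSMul u (kostantSMul v x)).symm
    simp [incl_kostantSMul]))
  smul_zero u := incl_injective n r ((incl_kostantSMul _ _).trans (by simp))
  smul_add u x y := incl_injective n r ((incl_kostantSMul _ _).trans (by
    refine Eq.trans ?_ (map_add (incl n r) (kostantSMul u x) (kostantSMul u y)).symm
    simp [incl_kostantSMul]))
  add_smul u v x := incl_injective n r ((incl_kostantSMul _ _).trans (by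
    refine Eq.trans ?_ (map_add (incl n r) (kostantSMul u x) (kostantSMul v x)).symm
    simp [incl_kostantSMul]))
  zero_smul x := incl_injective n r ((incl_kostantSMul _ _).trans (by simp))

theorem incl_smul {n r : ℕ} (u : kostantFormGL n) (x : VZPow n r) :
    incl n r (u • x) = uAction n r u (incl n r x) := incl_kostantSMul u x

/-- The `U'_ℤ`-module `V_ℤ^{⊗ r}`, by restriction from `U_ℤ`. -/
instance moduleSL (n r : ℕ) : Module (kostantFormSL n) (VZPow n r) :=
  Module.compHom (R := kostantFormGL n) _ (Subring.inclusion (kostantFormSL_le n))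

theorem smul_sl_def {n r : ℕ} (u : kostantFormSL n) (x : VZPow n r) :
    u • x = Subring.inclusion (kostantFormSL_le n) u • x := rfl

/-- Place permutation by `σ`:
`σ (x₁ ⊗ ⋯ ⊗ xᵣ) = x_{σ⁻¹(1)} ⊗ ⋯ ⊗ x_{σ⁻¹(r)}`. -/
def placePerm {n r : ℕ} (σ : Equiv.Perm (Fin r)) : VZPow n r →ₗ[ℤ] VZPow n r :=
  (PiTensorProduct.reindex ℤ (fun _ : Fin r => Fin n → ℤ) σ).toLinearMap

theorem placePerm_tprod {n r : ℕ} (σ : Equiv.Perm (Fin r)) (v : Fin r → Fin n → ℤ) :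
    placePerm σ (PiTensorProduct.tprod ℤ v) = PiTensorProduct.tprod ℤ fun p => v (σ⁻¹ p) :=
  PiTensorProduct.reindex_tprod σ v

/-- Place permutations commute with the action of `U_ℤ`. -/
theorem placePerm_smul {n r : ℕ} (σ : Equiv.Perm (Fin r)) (u : kostantFormGL n)
    (x : VZPow n r) : placePerm σ (u • x) = u • placePerm σ x := by
  let Q : Module.End ℂ (VPow n r) :=
    (PiTensorProduct.reindex ℂ (fun _ : Fin r => Fin n → ℂ) σ).toLinearMap
  have hQ : ∀ v, Q (PiTensorProduct.tprod ℂ v) = PiTensorProduct.tprod ℂ fun p => v (σ⁻¹ p) :=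
    fun v => PiTensorProduct.reindex_tprod σ v
  have hincl : ∀ x : VZPow n r, incl n r (placePerm σ x) = Q (incl n r x) := by
    intro x
    induction x using PiTensorProduct.induction_on with
    | smul_tprod a v => simp only [map_smul, placePerm_tprod, incl_tprod, map_zsmul, hQ]
    | add x y hx hy => simp only [map_add, hx, hy]
  have hslot : ∀ (p : Fin r) (A : gl n), Q * slot p A = slot (σ p) A * Q := by
    intro p A
    refine PiTensorProduct.ext (MultilinearMap.ext fun v => ?_)
    simp only [LinearMap.compMultilinearMap_apply, Module.End.mul_apply, slot_tprod, hQ]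
    congr 1
    ext1 q
    by_cases h : q = σ p
    · subst h; simp
    · have h' : σ⁻¹ q ≠ p := fun h' => h (by simp [← h'])
      rw [Function.update_of_ne h, Function.update_of_ne h']
  have hgl : ∀ A : gl n, Q * glAction n r A = glAction n r A * Q := by
    intro A
    change Q * ∑ p, slot p A = (∑ p, slot p A) * Q
    rw [Finset.mul_sum, Finset.sum_mul, ← Equiv.sum_comp σ (fun p => slot p A * Q)]
    exact Finset.sum_congr rfl fun p _ => hslot p A
  have hu : ∀ w : U n, Q * uAction n r w = uAction n r w * Q := by
    intro w
    let E : VPow n r ≃ₗ[ℂ] VPow n r := PiTensorProduct.reindex ℂ (fun _ : Fin r => Fin n → ℂ) σ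
    have key : (E.conjAlgEquiv ℂ).toAlgHom.comp (uAction n r) = uAction n r := by
      apply UniversalEnvelopingAlgebra.hom_ext (R := ℂ) (L := gl n) (A := Module.End ℂ (VPow n r))
      ext1 A
      refine LinearMap.ext fun y => ?_
      obtain ⟨x, rfl⟩ := E.surjective y
      have hA := LinearMap.congr_fun (hgl A) x
      have hι : uAction n r (UniversalEnvelopingAlgebra.ι ℂ A) = glAction n r A :=
        UniversalEnvelopingAlgebra.lift_ι_apply ℂ (glAction n r) A
      change E (uAction n r (UniversalEnvelopingAlgebra.ι ℂ A) (E.symm (E x))) =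
        uAction n r (UniversalEnvelopingAlgebra.ι ℂ A) (E x)
      rw [E.symm_apply_apply, hι]
      exact hA
    refine LinearMap.ext fun x => ?_
    have hx : E (uAction n r w (E.symm (E x))) = uAction n r w (E x) :=
      LinearMap.congr_fun (AlgHom.congr_fun key w) (E x)
    rw [E.symm_apply_apply] at hx
    exact hx
  apply incl_injective
  rw [hincl, incl_smul, incl_smul, hincl]
  exact LinearMap.congr_fun (hu u) _

theorem placePerm_one {n r : ℕ} (x : VZPow n r) : placePerm 1 x = x := by
  induction x using PiTensorProduct.induction_on with
  | smul_tprod a v => rw [map_smul, placePerm_tprod]; rfl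
  | add x y hx hy => rw [map_add, hx, hy]

theorem placePerm_mul {n r : ℕ} (σ τ : Equiv.Perm (Fin r)) (x : VZPow n r) :
    placePerm (σ * τ) x = placePerm σ (placePerm τ x) := by
  induction x using PiTensorProduct.induction_on with
  | smul_tprod a v =>
    rw [map_smul, map_smul, map_smul, placePerm_tprod, placePerm_tprod, placePerm_tprod]; rfl
  | add x y hx hy => simp only [map_add, hx, hy]

/-- The natural ring homomorphism `ℤ 𝔖ᵣ → End_{U_ℤ}(V_ℤ^{⊗ r})`. -/
def rhoGL (n r : ℕ) :
    MonoidAlgebra ℤ (Equiv.Perm (Fin r)) →ₐ[ℤ] Module.End (kostantFormGL n) (VZPow n r) :=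
  MonoidAlgebra.lift ℤ _ _
    { toFun := fun σ =>
        { toFun := placePerm σ
          map_add' := map_add _
          map_smul' := placePerm_smul σ }
      map_one' := LinearMap.ext placePerm_one
      map_mul' := fun σ τ => LinearMap.ext (placePerm_mul σ τ) }

/-- The natural ring homomorphism `ℤ 𝔖ᵣ → End_{U'_ℤ}(V_ℤ^{⊗ r})`. -/
def rhoSL (n r : ℕ) :
    MonoidAlgebra ℤ (Equiv.Perm (Fin r)) →ₐ[ℤ] Module.End (kostantFormSL n) (VZPow n r) :=
  MonoidAlgebra.lift ℤ _ _
    { toFun := fun σ =>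
        { toFun := placePerm σ
          map_add' := map_add _
          map_smul' := fun u => placePerm_smul σ (Subring.inclusion (kostantFormSL_le n) u) }
      map_one' := LinearMap.ext placePerm_one
      map_mul' := fun σ τ => LinearMap.ext (placePerm_mul σ τ) }

end SchurWeyl

end

noncomputable section

namespace SchurWeyl

open Finset

attribute [local instance] LieRing.ofAssociativeRing

/-! Extend an endomorphism commuting with `U'_ℤ` to a complex one, `Φ`. It commutes with the
off-diagonal matrix units, hence with all of `𝔤𝔩ₙ` (`commute_glAction`), so Schur–Weyl duality over
`ℂ` (`mem_span_placePermC`) writes `Φ` as a complex combination of place permutations. What remains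
is to find integral coefficients.

Place permutations may be linearly dependent, so one restricts to those `w` whose word splits into
`n` increasing subwords. These suffice: any other `w` is decreasing on more than `n` places, and the
antisymmetrizer of those places, which kills the tensor power, rewrites `w` through
lexicographically smaller permutations (`placePermC_mem_span`). They are also unitriangular: if `f`
colours the subwords of `w`, then the matrix entry at `(f, f ∘ w⁻¹)` is `1` for `w` and vanishes for
every other permutation that is not lexicographically larger (`toLex_lt_of_comp_eq`). Since `Φ`
preserves the lattice, descending induction makes every coefficient an integer
(`exists_int_of_integral`).

The statement for `U_ℤ` follows, as commuting with `U_ℤ` implies commuting with `U'_ℤ`. -/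

theorem mem_of_add_mem_left {M : Type*} [AddCommMonoid M] [Module ℂ M] (R : Submodule ℂ M)
    {a b : M} (hab : a + b ∈ R) (hb : b ∈ R) : a ∈ R := by
  let _ : AddCommGroup M := Module.addCommMonoidToAddCommGroup ℂ
  exact (R.add_mem_iff_left hb).1 hab

theorem exists_linearProjection {M : Type*} [AddCommMonoid M] [Module ℂ M]
    (R : Submodule ℂ M) : ∃ p : M →ₗ[ℂ] R, ∀ x : R, p x = x := by
  let _ : AddCommGroup M := Module.addCommMonoidToAddCommGroup ℂ
  obtain ⟨p, hp⟩ := LinearMap.exists_leftInverse_of_injective R.subtype R.ker_subtype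
  exact ⟨p, fun x => LinearMap.congr_fun hp x⟩

/-! ### Place permutations and tensor products of matrices -/

/-- Place permutation on the complex tensor power. -/
def placePermC {n r : ℕ} (σ : Equiv.Perm (Fin r)) : Module.End ℂ (VPow n r) :=
  (PiTensorProduct.reindex ℂ (fun _ : Fin r => Fin n → ℂ) σ).toLinearMap

theorem placePermC_tprod {n r : ℕ} (σ : Equiv.Perm (Fin r)) (v : Fin r → Fin n → ℂ) :
    placePermC σ (PiTensorProduct.tprod ℂ v) = PiTensorProduct.tprod ℂ fun p => v (σ⁻¹ p) :=
  PiTensorProduct.reindex_tprod σ v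

theorem placePermC_basisC {n r : ℕ} (σ : Equiv.Perm (Fin r)) (f : Fin r → Fin n) :
    placePermC σ (basisC n r f) = basisC n r (f ∘ ⇑σ⁻¹) := by
  simp only [basisC, Basis.piTensorProduct_apply, placePermC_tprod, Function.comp_apply]

theorem placePerm_basisZ {n r : ℕ} (σ : Equiv.Perm (Fin r)) (f : Fin r → Fin n) :
    placePerm σ (basisZ n r f) = basisZ n r (f ∘ ⇑σ⁻¹) := by
  simp only [basisZ, Basis.piTensorProduct_apply, placePerm_tprod, Function.comp_apply]

theorem placePermC_one {n r : ℕ} : (placePermC 1 : Module.End ℂ (VPow n r)) = 1 :=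
  (basisC n r).ext fun f => by simp [placePermC_basisC]

theorem placePermC_mul {n r : ℕ} (σ τ : Equiv.Perm (Fin r)) :
    (placePermC (σ * τ) : Module.End ℂ (VPow n r)) = placePermC σ * placePermC τ :=
  (basisC n r).ext fun f => by
    simp only [placePermC_basisC, Module.End.mul_apply, mul_inv_rev]
    rfl

/-- The endomorphism `F 1 ⊗ ⋯ ⊗ F r` of the tensor power. -/
def tensorEnd {n r : ℕ} (F : Fin r → gl n) : Module.End ℂ (VPow n r) :=
  PiTensorProduct.mapMonoidHom fun q => Matrix.toLin' (F q)

theorem tensorEnd_tprod {n r : ℕ} (F : Fin r → gl n) (v : Fin r → Fin n → ℂ) :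
    tensorEnd F (PiTensorProduct.tprod ℂ v) =
      PiTensorProduct.tprod ℂ fun q => (F q).mulVec (v q) := by
  simp only [tensorEnd, PiTensorProduct.mapMonoidHom_apply, PiTensorProduct.map_tprod,
    Matrix.toLin'_apply]

theorem tensorEnd_one {n r : ℕ} : tensorEnd (1 : Fin r → gl n) = 1 := by
  refine PiTensorProduct.ext (MultilinearMap.ext fun v => ?_)
  simp [tensorEnd_tprod]

theorem slot_mul_tensorEnd {n r : ℕ} (p : Fin r) (A : gl n) (F : Fin r → gl n) :
    slot p A * tensorEnd F = tensorEnd (Function.update F p (A * F p)) := by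
  refine PiTensorProduct.ext (MultilinearMap.ext fun v => ?_)
  simp only [LinearMap.compMultilinearMap_apply, Module.End.mul_apply, slot_tprod,
    tensorEnd_tprod]
  congr 1
  ext1 q
  by_cases h : q = p
  · subst h; simp
  · simp [h]

theorem placePermC_mul_tensorEnd {n r : ℕ} (σ : Equiv.Perm (Fin r)) (F : Fin r → gl n) :
    placePermC σ * tensorEnd F = tensorEnd (F ∘ ⇑σ⁻¹) * placePermC σ := by
  refine PiTensorProduct.ext (MultilinearMap.ext fun v => ?_)
  simp only [LinearMap.compMultilinearMap_apply, Module.End.mul_apply, placePermC_tprod,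
    tensorEnd_tprod, Function.comp_apply]

/-! ### Schur–Weyl duality over `ℂ` -/

/-- The sum of all place permutations of `F 1 ⊗ ⋯ ⊗ F r`. -/
def symEnd {n r : ℕ} (F : Fin r → gl n) : Module.End ℂ (VPow n r) :=
  ∑ σ : Equiv.Perm (Fin r), tensorEnd (F ∘ ⇑σ)

theorem symEnd_comp {n r : ℕ} (F : Fin r → gl n) (τ : Equiv.Perm (Fin r)) :
    symEnd (F ∘ ⇑τ) = symEnd F :=
  Equiv.sum_comp (Equiv.mulLeft τ) fun σ : Equiv.Perm (Fin r) => tensorEnd (F ∘ ⇑σ)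

theorem glAction_mul_symEnd {n r : ℕ} (B : gl n) (F : Fin r → gl n) :
    glAction n r B * symEnd F = ∑ j, symEnd (Function.update F j (B * F j)) := by
  change (∑ p, slot p B) * symEnd F = _
  simp only [symEnd, Finset.mul_sum]
  rw [Finset.sum_comm]
  refine Finset.sum_congr rfl fun σ _ => ?_
  rw [Finset.sum_mul,
    ← Equiv.sum_comp σ fun j => tensorEnd (Function.update F j (B * F j) ∘ ⇑σ)]
  refine Finset.sum_congr rfl fun p _ => ?_
  rw [slot_mul_tensorEnd, Function.update_comp_eq_of_injective _ σ.injective]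
  rfl

/-- Polarization, by induction on the number of non-identity factors. Multiplying the symmetrization
with one factor removed by the action of that factor restores the original, with positive
multiplicity, plus terms with fewer non-identity factors. -/
theorem symEnd_mem {n r : ℕ} (C : Subalgebra ℂ (Module.End ℂ (VPow n r)))
    (hC : ∀ B, glAction n r B ∈ C) (F : Fin r → gl n) : symEnd F ∈ C := by
  classical
  induction hk : #{i | F i ≠ 1} using Nat.strong_induction_on generalizing F with
  | _ k ih =>
  subst hk
  by_cases h1 : ∀ i, F i = 1
  · obtain rfl : F = 1 := funext h1
    refine C.sum_mem fun σ _ => ?_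
    have : (1 : Fin r → gl n) ∘ ⇑σ = 1 := rfl
    rw [this, tensorEnd_one]
    exact C.one_mem
  push Not at h1
  obtain ⟨i, hi⟩ := h1
  set F' := Function.update F i 1 with hF'
  have hF'i : F' i = 1 := by simp [hF']
  have hF'j : ∀ j, j ≠ i → F' j = F j := fun j hj => by simp [hF', hj]
  have hsub : (univ.filter fun j => F' j ≠ 1) ⊆ (univ.filter fun j => F j ≠ 1).erase i := by
    intro j
    by_cases hj : j = i
    · subst hj; simp [hF'i]
    · simp [hF'j j hj, hj]
  have hlt : ((univ.filter fun j => F j ≠ 1).erase i).card < #{j | F j ≠ 1} :=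
    Finset.card_erase_lt_of_mem (by simpa using hi)
  have hF'C : symEnd F' ∈ C := ih _ ((card_le_card hsub).trans_lt hlt) F' rfl
  have hsum := glAction_mul_symEnd (F i) F'
  -- Placing `F i` in any free slot gives the same symmetrization, since the slots differ by a swap.
  have hone : ∀ j, F' j = 1 → symEnd (Function.update F' j (F i * F' j)) = symEnd F := by
    intro j hj
    rw [← symEnd_comp F (Equiv.swap i j)]
    congr 1
    ext1 q
    rw [hj, mul_one, Function.comp_apply]
    by_cases hq : q = j
    · subst hq; simp
    · rw [Function.update_of_ne hq]
      by_cases hqi : q = i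
      · subst hqi
        rw [Equiv.swap_apply_left, hF'i, ← hF'j j (Ne.symm hq), hj]
      · rw [Equiv.swap_apply_of_ne_of_ne hqi hq, hF'j q hqi]
  -- In an occupied slot the factors merge, so the count stays below that of `F`.
  have hlow : ∀ j, F' j ≠ 1 → symEnd (Function.update F' j (F i * F' j)) ∈ C := by
    intro j hj
    refine ih _ (lt_of_le_of_lt (card_le_card ?_) hlt) _ rfl
    refine Finset.Subset.trans ?_ hsub
    intro q
    by_cases hq : q = j
    · subst hq; simp [hj]
    · simp [hq]
  rw [← Finset.sum_filter_add_sum_filter_not univ (fun j => F' j = 1),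
    Finset.sum_congr rfl fun j hj => hone j (Finset.mem_filter.1 hj).2, Finset.sum_const,
    ← Nat.cast_smul_eq_nsmul ℂ] at hsum
  have hm : ((#{j | F' j = 1} : ℕ) : ℂ) ≠ 0 :=
    Nat.cast_ne_zero.2 (Finset.card_ne_zero.2 ⟨i, by simp [hF'i]⟩)
  have hmem : ((#{j | F' j = 1} : ℕ) : ℂ) • symEnd F ∈ C := by
    have hadd := C.mul_mem (hC (F i)) hF'C
    rw [hsum] at hadd
    exact mem_of_add_mem_left (Subalgebra.toSubmodule C) hadd
      (C.sum_mem fun j hj => hlow j (Finset.mem_filter.1 hj).2)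
  have := C.smul_mem hmem (((#{j | F' j = 1} : ℕ) : ℂ)⁻¹)
  rwa [smul_smul, inv_mul_cancel₀ hm, one_smul] at this

theorem tensorEnd_single_basisC {n r : ℕ} (f g h : Fin r → Fin n) :
    tensorEnd (fun p => Matrix.single (f p) (g p) (1 : ℂ)) (basisC n r h) =
      if h = g then basisC n r f else 0 := by
  simp only [basisC, Basis.piTensorProduct_apply, tensorEnd_tprod, Pi.basisFun_apply]
  split_ifs with hg
  · subst hg
    congr 1
    ext p i
    simp [Matrix.single_apply, Pi.single_apply, eq_comm]
  · obtain ⟨p, hp⟩ := Function.ne_iff.1 hg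
    exact MultilinearMap.map_coord_zero _ p (by ext i; simp [Ne.symm hp])

/-- Tensor products of matrix units are the elementary matrices of the tensor power, so symmetrizing
them reaches every invariant endomorphism. -/
theorem eq_sum_tensorEnd {n r : ℕ} (T : Module.End ℂ (VPow n r)) :
    T = ∑ g, ∑ f, (basisC n r).repr (T (basisC n r g)) f •
      tensorEnd (fun p => Matrix.single (f p) (g p) (1 : ℂ)) := by
  refine (basisC n r).ext fun h => ?_
  simp only [LinearMap.sum_apply, LinearMap.smul_apply, tensorEnd_single_basisC]
  rw [Finset.sum_eq_single h]
  · simp [(basisC n r).sum_repr]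
  · intro g _ hg
    simp [hg.symm]
  · simp

/-- A subalgebra containing `𝔤𝔩ₙ` contains all endomorphisms commuting with the symmetric
group. -/
theorem mem_of_commute_placePermC {n r : ℕ} (C : Subalgebra ℂ (Module.End ℂ (VPow n r)))
    (hC : ∀ B, glAction n r B ∈ C) (T : Module.End ℂ (VPow n r))
    (hT : ∀ σ, Commute (placePermC σ) T) : T ∈ C := by
  have hconj : ∀ σ : Equiv.Perm (Fin r), placePermC σ⁻¹ * T * placePermC σ = T := by
    intro σ
    rw [(hT _).eq, mul_assoc, ← placePermC_mul, inv_mul_cancel, placePermC_one, mul_one]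
  have hF : ∀ F : Fin r → gl n,
      ∑ σ : Equiv.Perm (Fin r), placePermC σ⁻¹ * tensorEnd F * placePermC σ = symEnd F := by
    intro F
    refine Finset.sum_congr rfl fun σ _ => ?_
    rw [placePermC_mul_tensorEnd, mul_assoc, ← placePermC_mul, inv_mul_cancel, placePermC_one,
      mul_one, inv_inv]
  -- `T` equals its conjugation average; expanding in matrix units turns the average into
  -- symmetrized tensors.
  have hsum : ((r ! : ℕ) : ℂ) • T ∈ C := by
    have h1 : ((r ! : ℕ) : ℂ) • T =
        ∑ σ : Equiv.Perm (Fin r), placePermC σ⁻¹ * T * placePermC σ := by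
      simp only [hconj, Finset.sum_const, Finset.card_univ, Fintype.card_perm, Fintype.card_fin,
        Nat.cast_smul_eq_nsmul]
    have h2 : ∑ σ : Equiv.Perm (Fin r), placePermC σ⁻¹ * T * placePermC σ =
        ∑ g, ∑ f, (basisC n r).repr (T (basisC n r g)) f •
          symEnd (fun p => Matrix.single (f p) (g p) (1 : ℂ)) := by
      conv_lhs => rw [eq_sum_tensorEnd T]
      simp only [Finset.mul_sum, Finset.sum_mul, mul_smul_comm, smul_mul_assoc, ← hF,
        Finset.smul_sum]
      rw [Finset.sum_comm]
      exact Finset.sum_congr rfl fun g _ => Finset.sum_comm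
    rw [h1, h2]
    exact C.sum_mem fun g _ => C.sum_mem fun f _ => C.smul_mem (symEnd_mem C hC _) _
  have := C.smul_mem hsum (((r ! : ℕ) : ℂ)⁻¹)
  rwa [smul_smul, inv_mul_cancel₀ (Nat.cast_ne_zero.2 r.factorial_ne_zero), one_smul] at this

/-- Schur–Weyl duality over `ℂ`: an endomorphism commuting with `𝔤𝔩ₙ` is a linear combination of
place permutations. -/
theorem mem_span_placePermC {n r : ℕ} (ψ : Module.End ℂ (VPow n r))
    (hψ : ∀ B, Commute ψ (glAction n r B)) :
    ψ ∈ Submodule.span ℂ (Set.range (placePermC : _ → Module.End ℂ (VPow n r))) := by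
  set R := Submodule.span ℂ (Set.range (placePermC : _ → Module.End ℂ (VPow n r))) with hR
  have hRmul : ∀ σ, ∀ X ∈ R, placePermC σ * X ∈ R := by
    intro σ X hX
    have : R ≤ R.comap (LinearMap.mulLeft ℂ (placePermC σ)) := by
      rw [hR, Submodule.span_le]
      rintro _ ⟨τ, rfl⟩
      exact Submodule.subset_span ⟨σ * τ, placePermC_mul σ τ⟩
    exact this hX
  obtain ⟨π₀, hπ₀⟩ := exists_linearProjection R
  have hπ₀' : ∀ X (hX : X ∈ R), (π₀ X : Module.End ℂ (VPow n r)) = X := fun X hX =>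
    congrArg Subtype.val (hπ₀ ⟨X, hX⟩)
  -- Maschke averaging without the factor `1 / r!`: a map onto the span of the place permutations,
  -- equivariant for left multiplication. If it also commutes with left multiplication by `ψ`, then
  -- `π ψ = ψ * π 1 = r! ψ` lies in that span.
  let π : Module.End ℂ (VPow n r) →ₗ[ℂ] Module.End ℂ (VPow n r) :=
    ∑ σ : Equiv.Perm (Fin r), LinearMap.mulLeft ℂ (placePermC σ) ∘ₗ R.subtype ∘ₗ π₀ ∘ₗ
      LinearMap.mulLeft ℂ (placePermC σ⁻¹)
  have hπ : ∀ X, π X = ∑ σ : Equiv.Perm (Fin r),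
      placePermC σ * (π₀ (placePermC σ⁻¹ * X) : Module.End ℂ (VPow n r)) := by
    intro X
    simp [π, LinearMap.sum_apply]
  have hπR : ∀ X, π X ∈ R := fun X => by
    rw [hπ]
    exact R.sum_mem fun σ _ => hRmul σ _ (π₀ _).2
  have hπ1 : π 1 = ((r ! : ℕ) : ℂ) • 1 := by
    have h1 : ∀ σ : Equiv.Perm (Fin r),
        placePermC σ * (π₀ (placePermC σ⁻¹ * 1) : Module.End ℂ (VPow n r)) = 1 := by
      intro σ
      rw [hπ₀' _ (by rw [mul_one]; exact Submodule.subset_span ⟨_, rfl⟩), mul_one,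
        ← placePermC_mul, mul_inv_cancel, placePermC_one]
    rw [hπ]
    simp only [h1, Finset.sum_const, Finset.card_univ, Fintype.card_perm, Fintype.card_fin,
        Nat.cast_smul_eq_nsmul]
  have hequiv : ∀ τ X, π (placePermC τ * X) = placePermC τ * π X := by
    intro τ X
    rw [hπ, hπ, Finset.mul_sum, ← Equiv.sum_comp (Equiv.mulLeft τ)]
    refine Finset.sum_congr rfl fun σ _ => ?_
    rw [Equiv.coe_mulLeft, ← mul_assoc, ← mul_assoc, ← placePermC_mul, ← placePermC_mul,
      mul_inv_rev, inv_mul_cancel_right]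
  -- The `ε f` embed the tensor power as the columns of the endomorphism algebra, compatibly with
  -- left multiplication.
  let ε : (Fin r → Fin n) → VPow n r →ₗ[ℂ] Module.End ℂ (VPow n r) := fun f =>
    { toFun := fun x => ((basisC n r).coord f).smulRight x
      map_add' := fun x y => by ext; simp
      map_smul' := fun c x => by
        refine LinearMap.ext fun y => ?_
        simp [smul_comm c] }
  have hε : ∀ f x (X : Module.End ℂ (VPow n r)), ε f (X x) = X * ε f x := fun f x X => by
    refine LinearMap.ext fun y => ?_
    simp [ε]
  have hdec : ∀ X : Module.End ℂ (VPow n r), X = ∑ f, ε f (X (basisC n r f)) := by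
    intro X
    refine (basisC n r).ext fun g => ?_
    simp [ε, LinearMap.sum_apply, Finsupp.single_apply]
  have hcomm : ∀ X, π (ψ * X) = ψ * π X := by
    intro X
    have hf : ∀ f x, π (ε f (ψ x)) = ψ * π (ε f x) := by
      intro f x
      refine LinearMap.ext fun y => ?_
      -- For fixed `f` and `y` this map commutes with the symmetric group, so it lies in every
      -- subalgebra containing `𝔤𝔩ₙ`, in particular in the centralizer of `ψ`.
      let T : Module.End ℂ (VPow n r) := LinearMap.applyₗ y ∘ₗ π ∘ₗ ε f
      have hT : ∀ σ, Commute (placePermC σ) T := fun σ => by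
        refine LinearMap.ext fun z => ?_
        change placePermC σ (π (ε f z) y) = π (ε f (placePermC σ z)) y
        rw [hε, hequiv]
        rfl
      have hmem := mem_of_commute_placePermC (Subalgebra.centralizer ℂ {ψ})
        (fun B => by
          rw [Subalgebra.mem_centralizer_iff]
          rintro _ rfl
          exact (hψ B).eq) T hT
      rw [Subalgebra.mem_centralizer_iff] at hmem
      exact (LinearMap.congr_fun (hmem ψ rfl) x).symm
    conv_lhs => rw [hdec X]
    conv_rhs => rw [hdec X]
    simp only [Finset.mul_sum, map_sum, ← hε]
    exact Finset.sum_congr rfl fun f _ => hf f _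
  have key := hπR ψ
  rw [← mul_one ψ, hcomm, hπ1, mul_smul_comm] at key
  have := R.smul_mem ((r ! : ℂ)⁻¹) key
  rwa [smul_smul, inv_mul_cancel₀ (Nat.cast_ne_zero.2 r.factorial_ne_zero), one_smul,
    mul_one] at this

/-! ### Straightening to increasingly colorable permutations -/

/-- A permutation whose one-line word can be partitioned into `n` increasing subwords. -/
def IncreasingColorable {r : ℕ} (n : ℕ) (w : Equiv.Perm (Fin r)) : Prop :=
  ∃ f : Fin r → Fin n, ∀ i j, i < j → f i = f j → w i < w j

/-- Colour each position by the length of the longest decreasing subword ending there. Two positions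
of equal colour cannot form a descent, since the later one would extend the subword; if no
decreasing subword exceeds `n`, then `n` colours suffice. -/
theorem exists_strictAntiOn_of_not_increasingColorable {n r : ℕ} {w : Equiv.Perm (Fin r)}
    (hw : ¬ IncreasingColorable n w) :
    ∃ T : Finset (Fin r), n < #T ∧ StrictAntiOn w (T : Set (Fin r)) := by
  classical
  by_contra! hT
  let D : Fin r → Finset (Finset (Fin r)) := fun i =>
    univ.filter fun T => (i ∈ T ∧ ∀ j ∈ T, j ≤ i) ∧ StrictAntiOn w (T : Set (Fin r))
  have hD : ∀ i T, T ∈ D i ↔ (i ∈ T ∧ ∀ j ∈ T, j ≤ i) ∧ StrictAntiOn w (T : Set (Fin r)) := by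
    simp [D]
  let h : Fin r → ℕ := fun i => (D i).sup card
  have hmem : ∀ i, ∃ T ∈ D i, #T = h i := by
    intro i
    have hne : (D i).Nonempty := ⟨{i}, by simp [hD]⟩
    obtain ⟨T, hT, hs⟩ := Finset.exists_mem_eq_sup (D i) hne card
    exact ⟨T, hT, hs.symm⟩
  have hpos : ∀ i, 0 < h i := fun i => by
    obtain ⟨T, hT, hs⟩ := hmem i
    rw [← hs]
    exact card_pos.2 ⟨i, ((hD i T).1 hT).1.1⟩
  have hle : ∀ i, h i ≤ n := fun i => by
    obtain ⟨T, hT', hs⟩ := hmem i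
    rw [← hs]
    by_contra! hlt
    exact hT T hlt ((hD i T).1 hT').2
  -- The lengths lie between `1` and `n`, hence the shift by one.
  refine hw ⟨fun i => ⟨h i - 1, by have := hpos i; have := hle i; omega⟩, fun i j hij hf => ?_⟩
  by_contra! hwj
  have hwij : w j < w i := lt_of_le_of_ne hwj fun h => hij.ne' (w.injective h)
  obtain ⟨T, hTi, hs⟩ := hmem i
  obtain ⟨⟨hiT, hTle⟩, hanti⟩ := (hD i T).1 hTi
  have hjT : j ∉ T := fun hj => absurd (hTle j hj) (not_le.2 hij)
  have hins : insert j T ∈ D j := by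
    rw [hD]
    refine ⟨⟨mem_insert_self _ _, fun k hk => ?_⟩, ?_⟩
    · rcases mem_insert.1 hk with rfl | hk
      · exact le_rfl
      · exact (hTle k hk).trans hij.le
    · intro a ha b hb hab
      rcases mem_insert.1 (mem_coe.1 ha) with haj | ha' <;>
        rcases mem_insert.1 (mem_coe.1 hb) with hbj | hb'
      · exact absurd hab (haj.trans hbj.symm).not_lt
      · exact absurd hab (not_lt.2 (haj ▸ (hTle b hb').trans hij.le))
      · exact hbj ▸ hwij.trans_le
          (hanti.antitoneOn (mem_coe.2 ha') (mem_coe.2 hiT) (hTle a ha'))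
      · exact hanti (mem_coe.2 ha') (mem_coe.2 hb') hab
  have hcard : #(insert j T) ≤ h j := Finset.le_sup (f := card) hins
  rw [card_insert_of_notMem hjT, hs] at hcard
  have h1 := hpos i
  have h2 := Fin.mk.inj_iff.1 hf
  omega

/-- The antisymmetrizer of more than `n` places annihilates the tensor power. -/
theorem sum_sign_smul_placePermC {n r : ℕ} (w : Equiv.Perm (Fin r)) (T : Finset (Fin r))
    (hT : n < #T) :
    ∑ π : Equiv.Perm (Fin r) with (∀ i ∉ T, π i = i),
      ((Equiv.Perm.sign π : ℤ) : ℂ) • (placePermC (w * π) : Module.End ℂ (VPow n r)) = 0 := by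
  classical
  refine (basisC n r).ext fun f => ?_
  -- By pigeonhole `f` repeats a value on `T`; swapping these two places pairs off terms of opposite
  -- sign.
  obtain ⟨i, hi, j, hj, hij, hf⟩ := Finset.exists_ne_map_eq_of_card_lt_of_maps_to
    (s := T) (t := univ) (f := f) (by simpa using hT) (by simp)
  have hfs : f ∘ ⇑(Equiv.swap i j) = f := by
    ext1 k
    simp only [Function.comp_apply, Equiv.swap_apply_def]
    split_ifs with h1 h2
    · rw [h1, hf]
    · rw [h2, hf]
    · rfl
  simp only [LinearMap.sum_apply, LinearMap.smul_apply, placePermC_basisC, LinearMap.zero_apply]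
  refine Finset.sum_involution (fun π _ => π * Equiv.swap i j) ?_ ?_ ?_ ?_
  · intro π _
    have h : f ∘ ⇑(w * (π * Equiv.swap i j))⁻¹ = f ∘ ⇑(w * π)⁻¹ := by
      rw [← mul_assoc, mul_inv_rev (w * π), Equiv.swap_inv, Equiv.Perm.coe_mul,
        ← Function.comp_assoc, hfs]
    rw [h, ← add_smul]
    simp [Equiv.Perm.sign_swap hij]
  · intro π _ _ h
    exact hij (Equiv.swap_eq_one_iff.1 (mul_eq_left.1 h))
  · intro π hπ
    rw [Finset.mem_filter] at hπ ⊢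
    refine ⟨mem_univ _, fun k hk => ?_⟩
    rw [Equiv.Perm.mul_apply, Equiv.swap_apply_of_ne_of_ne (ne_of_mem_of_not_mem hi hk).symm
      (ne_of_mem_of_not_mem hj hk).symm, hπ.2 k hk]
  · intro π _
    rw [mul_assoc, Equiv.swap_mul_self, mul_one]

/-- The first place moved by `π` lies in `T` and goes to a later place of `T`, where `w` is smaller.
-/
theorem toLex_mul_lt {r : ℕ} {w π : Equiv.Perm (Fin r)} {T : Finset (Fin r)}
    (hw : StrictAntiOn w (T : Set (Fin r))) (hπ : ∀ i ∉ T, π i = i) (h1 : π ≠ 1) :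
    toLex (⇑(w * π)) < toLex (⇑w) := by
  classical
  have hne : (univ.filter fun i => π i ≠ i).Nonempty := by
    by_contra h
    rw [Finset.not_nonempty_iff_eq_empty, Finset.filter_eq_empty_iff] at h
    exact h1 (Equiv.ext fun i => not_not.1 (h (mem_univ i)))
  obtain ⟨i, hi, hmin⟩ := Finset.exists_minimal hne
  have hi := (Finset.mem_filter.1 hi).2
  have hlt : ∀ j, j < i → π j = j := by
    intro j hj
    by_contra h
    exact absurd (hmin (Finset.mem_filter.2 ⟨mem_univ j, h⟩) hj.le) (not_le.2 hj)
  have hiT : i ∈ T := by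
    by_contra h
    exact hi (hπ i h)
  have hπT : π i ∈ T := by
    by_contra h
    exact hi (π.injective (hπ _ h))
  have hgt : i < π i := by
    refine lt_of_le_of_ne (le_of_not_gt fun h => ?_) (Ne.symm hi)
    exact hi (π.injective (hlt _ h))
  exact ⟨i, fun j hj => by simp [hlt j hj], by simpa using hw hiT hπT hgt⟩

/-- Induction on the lexicographic order of words: the antisymmetrizer relation on a long decreasing
subword expresses `w` through smaller permutations. -/
theorem placePermC_mem_span {n r : ℕ} (w : Equiv.Perm (Fin r)) :
    (placePermC w : Module.End ℂ (VPow n r)) ∈ Submodule.span ℂ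
      (Set.range fun v : {v : Equiv.Perm (Fin r) // IncreasingColorable n v} =>
        placePermC v.1) := by
  classical
  induction hx : toLex (⇑w) using WellFoundedLT.induction generalizing w with
  | _ x ih =>
  subst hx
  by_cases hw : IncreasingColorable n w
  · exact Submodule.subset_span ⟨⟨w, hw⟩, rfl⟩
  obtain ⟨T, hT, hanti⟩ := exists_strictAntiOn_of_not_increasingColorable hw
  have h := sum_sign_smul_placePermC (n := n) w T hT
  rw [← Finset.add_sum_erase _ _ (a := (1 : Equiv.Perm (Fin r))) (by simp)] at h
  simp only [Equiv.Perm.sign_one, Units.val_one, Int.cast_one, one_smul, mul_one] at h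
  refine mem_of_add_mem_left _ (h ▸ Submodule.zero_mem _)
    (Submodule.sum_mem _ fun π hπ => Submodule.smul_mem _ _ ?_)
  rw [Finset.mem_erase, Finset.mem_filter] at hπ
  exact ih _ (toLex_mul_lt hanti hπ.2.2 hπ.1) _ rfl

/-! ### Unitriangularity and integrality of the coefficients -/

/-- At the first difference `i`, the value `σ i` is taken by `w` at a place of the same colour. That
place comes after `i`, because `σ` and `w` agree earlier, so `w i < σ i`. -/
theorem toLex_lt_of_comp_eq {n r : ℕ} {w σ : Equiv.Perm (Fin r)} {f : Fin r → Fin n}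
    (hf : ∀ i j, i < j → f i = f j → w i < w j) (hσ : f ∘ ⇑w⁻¹ = f ∘ ⇑σ⁻¹) (hne : σ ≠ w) :
    toLex (⇑w) < toLex (⇑σ) := by
  classical
  have hne' : (univ.filter fun i => σ i ≠ w i).Nonempty := by
    by_contra h
    rw [Finset.not_nonempty_iff_eq_empty, Finset.filter_eq_empty_iff] at h
    exact hne (Equiv.ext fun i => not_not.1 (h (mem_univ i)))
  obtain ⟨i, hi, hmin⟩ := Finset.exists_minimal hne'
  have hi := (Finset.mem_filter.1 hi).2
  have hlt : ∀ j, j < i → σ j = w j := by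
    intro j hj
    by_contra h
    exact absurd (hmin (Finset.mem_filter.2 ⟨mem_univ j, h⟩) hj.le) (not_le.2 hj)
  have hk : f (w⁻¹ (σ i)) = f i := by simpa using congrFun hσ (σ i)
  have hgt : i < w⁻¹ (σ i) := by
    rcases lt_trichotomy i (w⁻¹ (σ i)) with h | h | h
    · exact h
    · exact absurd (Equiv.Perm.eq_inv_iff_eq.1 h).symm hi
    · have hwσ : w (w⁻¹ (σ i)) = σ i := w.apply_symm_apply _
      exact absurd (σ.injective ((hlt _ h).trans hwσ)) h.ne
  exact ⟨i, fun j hj => (hlt j hj).symm, by simpa using hf _ _ hgt hk.symm⟩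

open Classical in
/-- Place permutations by increasingly colorable permutations span a saturated lattice. -/
theorem exists_int_of_integral {n r : ℕ}
    (q : {v : Equiv.Perm (Fin r) // IncreasingColorable n v} → ℂ)
    (hq : ∀ f g, ∃ z : ℤ, (basisC n r).repr
      ((∑ v, q v • (placePermC v.1 : Module.End ℂ (VPow n r))) (basisC n r f)) g = z)
    (w : {v : Equiv.Perm (Fin r) // IncreasingColorable n v}) : ∃ z : ℤ, q w = z := by
  induction hx : toLex (⇑w.1) using WellFoundedGT.induction generalizing w with
  | _ x ih =>
  subst hx
  obtain ⟨f, hf⟩ := w.2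
  -- At this matrix entry `w` contributes exactly `q w`; any other contribution comes from a larger
  -- permutation, whose coefficient is already integral.
  obtain ⟨z, hz⟩ := hq f (f ∘ ⇑w.1⁻¹)
  simp only [LinearMap.sum_apply, LinearMap.smul_apply, placePermC_basisC, map_sum, map_smul,
    Finsupp.finsetSum_apply, Finsupp.smul_apply, Module.Basis.repr_self, smul_eq_mul] at hz
  rw [← Finset.add_sum_erase _ _ (mem_univ w), Finsupp.single_eq_same, mul_one] at hz
  rw [eq_sub_of_add_eq hz]
  suffices h : ∑ v ∈ univ.erase w, q v * (Finsupp.single (f ∘ ⇑v.1⁻¹) (1 : ℂ)) (f ∘ ⇑w.1⁻¹) ∈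
      (Int.castRingHom ℂ).range by
    obtain ⟨y, hy⟩ := h
    exact ⟨z - y, by rw [← hy]; simp⟩
  refine Subring.sum_mem _ fun v hv => ?_
  rw [Finsupp.single_apply]
  split_ifs with h
  · obtain ⟨y, hy⟩ := ih _ (toLex_lt_of_comp_eq hf h.symm
      fun h => (Finset.mem_erase.1 hv).1 (Subtype.ext h)) v rfl
    exact ⟨y, by rw [hy]; simp⟩
  · rw [mul_zero]
    exact Subring.zero_mem _

/-! ### Descent to `U'_ℤ` and to the lattice -/

theorem glAction_one {n r : ℕ} : glAction n r 1 = (r : ℂ) • 1 := by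
  have h : ∀ p : Fin r, slot p (1 : gl n) = 1 := fun p => by
    refine PiTensorProduct.ext (MultilinearMap.ext fun v => ?_)
    simp [slot_tprod]
  change ∑ p, slot p 1 = _
  simp [h, Nat.cast_smul_eq_nsmul]

/-- An endomorphism of the tensor power commuting with the off-diagonal matrix units commutes
with `𝔤𝔩ₙ`. -/
theorem commute_glAction {n r : ℕ} (ψ : Module.End ℂ (VPow n r))
    (h : ∀ i j, i ≠ j → Commute ψ (glAction n r (Matrix.single i j 1))) (B : gl n) :
    Commute ψ (glAction n r B) := by
  set C := Subalgebra.centralizer ℂ {ψ} with hC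
  have hmem : ∀ X, X ∈ C ↔ Commute ψ X := fun X => by
    simp [hC, Subalgebra.mem_centralizer_iff, Commute, SemiconjBy]
  let S : Submodule ℂ (gl n) :=
    (Subalgebra.toSubmodule C).comap (glAction n r : gl n →ₗ[ℂ] Module.End ℂ (VPow n r))
  have hS : ∀ X, X ∈ S ↔ Commute ψ (glAction n r X) := fun X => hmem _
  have hlie : ∀ X ∈ S, ∀ Y ∈ S, ⁅X, Y⁆ ∈ S := by
    intro X hX Y hY
    have hXY : glAction n r ⁅X, Y⁆ + glAction n r Y * glAction n r X =
        glAction n r X * glAction n r Y := by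
      rw [LieHom.map_lie, Ring.lie_def]
      exact sub_add_cancel _ _
    refine mem_of_add_mem_left (Subalgebra.toSubmodule C) ?_ (C.mul_mem hY hX)
    exact (congrArg (· ∈ Subalgebra.toSubmodule C) hXY).mpr (C.mul_mem hX hY)
  have hdiff : ∀ i j, (Matrix.single i i 1 - Matrix.single j j 1 : gl n) ∈ S := by
    intro i j
    by_cases hij : i = j
    · subst hij
      rw [sub_self]
      exact S.zero_mem
    · have hb : ⁅(Matrix.single i j 1 : gl n), (Matrix.single j i 1 : gl n)⁆ =
          Matrix.single i i 1 - Matrix.single j j 1 := by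
        rw [Ring.lie_def]
        simp
      rw [← hb]
      exact hlie _ ((hS _).2 (h i j hij)) _ ((hS _).2 (h j i (Ne.symm hij)))
  have hone : (1 : gl n) ∈ S := by
    rw [hS, glAction_one]
    exact (Commute.one_right ψ).smul_right _
  have hdiag : ∀ i, (Matrix.single i i 1 : gl n) ∈ S := by
    intro i
    have hn : (n : ℂ) ≠ 0 := Nat.cast_ne_zero.2 i.pos.ne'
    -- The commutators give only trace-zero diagonal matrices; the identity, acting as the scalar
    -- `r`, supplies the missing direction.
    have heq : (n : ℂ) • (Matrix.single i i 1 : gl n) =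
        ∑ j, (Matrix.single i i 1 - Matrix.single j j 1 : gl n) + 1 := by
      rw [Finset.sum_sub_distrib, Matrix.sum_single_one, sub_add_cancel]
      simp
    rw [← S.smul_mem_iff hn, heq]
    exact S.add_mem (S.sum_mem fun j _ => hdiff i j) hone
  rw [← hS, Matrix.matrix_eq_sum_single B]
  refine S.sum_mem fun i _ => S.sum_mem fun j _ => ?_
  have hs : (Matrix.single i j (B i j) : gl n) = B i j • Matrix.single i j 1 := by
    rw [Matrix.smul_single, smul_eq_mul, mul_one]
  rw [hs]
  refine S.smul_mem _ ?_
  by_cases hij : i = j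
  · subst hij
    exact hdiag i
  · exact (hS _).2 (h i j hij)

/-- An additive endomorphism of the lattice commuting with `U'_ℤ` is an integral
combination of place permutations. -/
theorem exists_eq_sum_placePerm {n r : ℕ} (ψ : VZPow n r →ₗ[ℤ] VZPow n r)
    (hψ : ∀ u : kostantFormSL n, ∀ x, ψ (u • x) = u • ψ x) :
    ∃ z : Equiv.Perm (Fin r) → ℤ, ∀ x, ψ x = ∑ σ, z σ • placePerm σ x := by
  classical
  let Φ : Module.End ℂ (VPow n r) :=
    (basisC n r).constr ℂ fun f => incl n r (ψ (basisZ n r f))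
  have hΦb : ∀ f, Φ (basisC n r f) = incl n r (ψ (basisZ n r f)) := fun f =>
    (basisC n r).constr_basis ℂ _ f
  have hΦ : ∀ x, Φ (incl n r x) = incl n r (ψ x) := by
    intro x
    rw [← (basisZ n r).sum_repr x]
    simp only [map_sum, map_smul, map_zsmul, incl_basisZ, hΦb]
  have hcomm : ∀ i j, i ≠ j → Commute Φ (glAction n r (Matrix.single i j 1)) := by
    intro i j hij
    -- Only first divided powers are needed to obtain commutation with the Lie algebra.
    have he : dividedPower (e i j) 1 = (e i j : U n) := by simp [dividedPower]
    have hmem : (e i j : U n) ∈ kostantFormSL n :=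
      Subring.subset_closure ⟨i, j, 1, hij, he.symm⟩
    have hact : ∀ x, incl n r ((⟨e i j, hmem⟩ : kostantFormSL n) • x) =
        glAction n r (Matrix.single i j 1) (incl n r x) := by
      intro x
      rw [smul_sl_def, incl_smul]
      exact LinearMap.congr_fun (uAction_e i j) _
    refine (basisC n r).ext fun f => ?_
    rw [Module.End.mul_apply, Module.End.mul_apply, ← incl_basisZ, ← hact, hΦ, hΦ, hψ, hact]
  have hspan : Φ ∈ Submodule.span ℂ
      (Set.range fun v : {v : Equiv.Perm (Fin r) // IncreasingColorable n v} =>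
        (placePermC v.1 : Module.End ℂ (VPow n r))) := by
    refine Submodule.span_le.2 ?_ (mem_span_placePermC Φ (commute_glAction Φ hcomm))
    rintro _ ⟨σ, rfl⟩
    exact placePermC_mem_span σ
  obtain ⟨q, hq⟩ := (Submodule.mem_span_range_iff_exists_fun ℂ).1 hspan
  have hint : ∀ v, ∃ z : ℤ, q v = z := by
    refine exists_int_of_integral q fun f g => ⟨(basisZ n r).repr (ψ (basisZ n r f)) g, ?_⟩
    rw [hq, hΦb]
    conv_lhs => rw [← (basisZ n r).sum_repr (ψ (basisZ n r f))]
    simp only [map_sum, map_smul, incl_basisZ, Finsupp.finsetSum_apply]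
    simp [← Int.cast_smul_eq_zsmul ℂ, Finsupp.single_apply]
  choose z hz using hint
  -- Permutations outside the spanning family receive coefficient zero.
  refine ⟨fun σ => if h : IncreasingColorable n σ then z ⟨σ, h⟩ else 0, fun x => ?_⟩
  have hfin : ψ = ∑ v : {v : Equiv.Perm (Fin r) // IncreasingColorable n v},
      z v • placePerm v.1 := by
    refine (basisZ n r).ext fun f => incl_injective n r ?_
    rw [← hΦb, ← hq]
    simp only [LinearMap.sum_apply, LinearMap.smul_apply, placePermC_basisC, map_sum, map_smul,
      placePerm_basisZ, incl_basisZ, hz, Int.cast_smul_eq_zsmul]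
  rw [hfin, LinearMap.sum_apply]
  simp only [dite_smul, zero_smul, Finset.sum_dite, Finset.sum_const_zero, add_zero,
    LinearMap.smul_apply]
  refine Finset.sum_bij' (fun v _ => ⟨v.1, mem_filter.2 ⟨mem_univ _, v.2⟩⟩)
    (fun v _ => ⟨v.1, (mem_filter.1 v.2).2⟩) ?_ ?_ ?_ ?_ ?_ <;> simp

end SchurWeyl
end

theorem mainTheorem4 (n r : ℕ) :
    Function.Surjective (SchurWeyl.rhoGL n r) ∧ Function.Surjective (SchurWeyl.rhoSL n r) := by
  constructor
  · intro ψ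
    obtain ⟨z, hz⟩ := SchurWeyl.exists_eq_sum_placePerm ψ.toAddMonoidHom.toIntLinearMap
      fun u x => ψ.map_smul (Subring.inclusion (SchurWeyl.kostantFormSL_le n) u) x
    refine ⟨∑ σ, MonoidAlgebra.single σ (z σ), LinearMap.ext fun x => ?_⟩
    refine Eq.trans ?_ (hz x).symm
    simp only [map_sum, LinearMap.sum_apply, SchurWeyl.rhoGL, MonoidAlgebra.lift_single]
    rfl
  · intro ψ
    obtain ⟨z, hz⟩ := SchurWeyl.exists_eq_sum_placePerm ψ.toAddMonoidHom.toIntLinearMap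
      fun u x => ψ.map_smul u x
    refine ⟨∑ σ, MonoidAlgebra.single σ (z σ), LinearMap.ext fun x => ?_⟩
    refine Eq.trans ?_ (hz x).symm
    simp only [map_sum, LinearMap.sum_apply, SchurWeyl.rhoSL, MonoidAlgebra.lift_single]
    rfl
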